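/- Consider the commutative algebra $\mathbb R^{\mathbb R}$ of all functions $\mathbb R\to\mathbb R$ with pointwise operations; subalgebras are linear subspaces closed under multiplication and need not contain the constant function $1$. For a cardinal $\kappa$, a set $E\subset\mathbb R^{\mathbb R}$ is called \emph{$\kappa$-algebrable} if $E\cup\{0\}$ contains a $\kappa$-generated subalgebra, i.e. a subalgebra whose least cardinality of a generating set is $\kappa$; it is called \emph{strongly $\kappa$-algebrable} if $E\cup\{0\}$ contains a subalgebra generated by a set $X$ with $|X|=\kappa$ of free generators, i.e. such that $P(x_1,\dots,x_n)\neq 0$ for every nonzero real polynomial $P$ without constant term and all distinct $x_1,\dots,x_n\in X$. A function $f:\mathbb R\to\mathbb R$ is \emph{nowhere continuous} if it is continuous at no point, \emph{Darboux} if it maps connected sets to connected sets, and \emph{compact-preserving} if it maps compact sets to compact sets. Let $\mathfrak c=|\mathbb R|$. Then: (i) the family of all nowhere continuous Darboux functions $f:\mathbb R\to\mathbb R$ that map every uncountable compact set to a compact set is strongly $2^{\mathfrak c}$-algebrable; (ii) the family of all nowhere continuous compact-preserving functions $f:\mathbb R\to\mathbb R$ is $2^{\mathfrak c}$-algebrable,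 but it is not strongly $1$-algebrable. -/

import Mathlib

open Cardinal

universe u v

section Algebrability

variable {K : Type v} {A : Type u} [Field K] [CommRing A] [Algebra K A]

/-- The (not necessarily unital) subalgebra `B` is `κ`-generated: `κ` is the least cardinality
of a set of generators of `B`. -/
def IsGeneratedByCard (B : NonUnitalSubalgebra K A) (κ : Cardinal.{u}) : Prop :=
  (∃ X : Set A, #X = κ ∧ NonUnitalAlgebra.adjoin K X = B) ∧
    ∀ Y : Set A, NonUnitalAlgebra.adjoin K Y = B → κ ≤ #Y

/-- `X` is a set of free generators of the (not necessarily unital) commutative subalgebra `B`: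
`X` generates `B`, and no nonzero polynomial without constant term vanishes at the (pairwise
distinct) elements of `X`. -/
def IsFreelyGeneratedBy (B : NonUnitalSubalgebra K A) (X : Set A) : Prop :=
  NonUnitalAlgebra.adjoin K X = B ∧
    ∀ P : MvPolynomial X K, MvPolynomial.constantCoeff P = 0 →
      MvPolynomial.aeval (fun x : X => (x : A)) P = 0 → P = 0

variable (K)

/-- `E` is `κ`-algebrable: `E ∪ {0}` contains a `κ`-generated algebra. -/
def IsAlgebrable (κ : Cardinal.{u}) (E : Set A) : Prop :=
  ∃ B : NonUnitalSubalgebra K A, (B : Set A) ⊆ E ∪ {0} ∧ IsGeneratedByCard B κ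

/-- `E` is strongly `κ`-algebrable: `E ∪ {0}` contains a free algebra with `κ` free
generators. -/
def IsStronglyAlgebrable (κ : Cardinal.{u}) (E : Set A) : Prop :=
  ∃ B : NonUnitalSubalgebra K A, (B : Set A) ⊆ E ∪ {0} ∧
    ∃ X : Set A, #X = κ ∧ IsFreelyGeneratedBy B X

end Algebrability

/-- `f` has no point of continuity. -/
def NowhereContinuous (f : ℝ → ℝ) : Prop := ∀ x, ¬ ContinuousAt f x

/-- `f` maps connected sets to connected sets. -/
def IsDarboux (f : ℝ → ℝ) : Prop := ∀ C : Set ℝ, IsConnected C → IsConnected (f '' C)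

/-- `f` maps compact sets to compact sets. -/
def CompactPreserving (f : ℝ → ℝ) : Prop := ∀ C : Set ℝ, IsCompact C → IsCompact (f '' C)

/-- `f` maps uncountable compact sets to compact sets. -/
def UncountableCompactPreserving (f : ℝ → ℝ) : Prop :=
  ∀ C : Set ℝ, IsCompact C → ¬ C.Countable → IsCompact (f '' C)

/-!
Fix `T ⊆ ℝ`. A Bernstein-type construction composed with the Fichtenholz–Kantorovich–Hausdorff
independent family yields `2 ^ 𝔠` functions `ℝ → T`, any finitely many of which take prescribed
values in `T` simultaneously at some point of each uncountable compact set. Hence a polynomial in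
these functions has the same image on every uncountable compact set, namely the set of its values
at `T`-valued arguments, and is nowhere continuous as soon as this set is not a singleton.

* For `T = [0, 1]` the common image is a continuous image of a cube, hence compact and connected,
  and the functions are algebraically independent because `T` is infinite.
* For `T = {0, 1}` the polynomials in these functions have finite range, so they preserve
  compactness; as `2 ^ 𝔠 > 𝔠`, the algebra cannot be generated by fewer than `2 ^ 𝔠` elements.
* Near a point `x`, a compact-preserving function `f` takes only finitely many values outside a
  given neighbourhood of `f x`. So if it is discontinuous somewhere, it takes only finitely many
  values on some nonempty open set. A nonzero polynomial vanishing at these values and at `0`,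
  applied to `f`, is zero on that open set, hence continuous at some point.
-/

open Filter Set Topology

section Polynomials

variable {R A ι : Type*} [CommSemiring R] [CommSemiring A] [Algebra R A]

theorem exists_mem_adjoin_aeval_eq_algebraMap_add (x : ι → A) (P : MvPolynomial ι R) :
    ∃ b ∈ NonUnitalAlgebra.adjoin R (range x),
      MvPolynomial.aeval x P = algebraMap R A (MvPolynomial.constantCoeff P) + b := by
  induction P using MvPolynomial.induction_on with
  | C r => exact ⟨0, zero_mem _, by simp⟩
  | add P Q hP hQ =>
    obtain ⟨b, hb, hPb⟩ := hP
    obtain ⟨c, hc, hQc⟩ := hQ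
    exact ⟨b + c, add_mem hb hc, by simp only [map_add, hPb, hQc]; ring⟩
  | mul_X P i hP =>
    obtain ⟨b, hb, hPb⟩ := hP
    have hi : x i ∈ NonUnitalAlgebra.adjoin R (range x) :=
      NonUnitalAlgebra.subset_adjoin R (mem_range_self i)
    refine ⟨MvPolynomial.constantCoeff P • x i + b * x i,
      add_mem (SMulMemClass.smul_mem _ hi) (mul_mem hb hi), ?_⟩
    simp only [map_mul, MvPolynomial.aeval_X, hPb, MvPolynomial.constantCoeff_X, mul_zero,
      map_zero, Algebra.smul_def]
    ring

theorem mem_nonUnitalAdjoin_range_iff {x : ι → A} {a : A} :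
    a ∈ NonUnitalAlgebra.adjoin R (range x) ↔
      ∃ P : MvPolynomial ι R, MvPolynomial.constantCoeff P = 0 ∧ MvPolynomial.aeval x P = a := by
  constructor
  · intro ha
    induction ha using NonUnitalAlgebra.adjoin_induction with
    | mem _ hx =>
      obtain ⟨i, rfl⟩ := hx
      exact ⟨MvPolynomial.X i, by simp, by simp⟩
    | zero => exact ⟨0, by simp, by simp⟩
    | add _ _ _ _ ha hb =>
      obtain ⟨P, hP, rfl⟩ := ha
      obtain ⟨Q, hQ, rfl⟩ := hb
      exact ⟨P + Q, by simp [hP, hQ], by simp⟩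
    | mul _ _ _ _ ha hb =>
      obtain ⟨P, hP, rfl⟩ := ha
      obtain ⟨Q, -, rfl⟩ := hb
      exact ⟨P * Q, by simp [hP], by simp⟩
    | smul r _ _ ha =>
      obtain ⟨P, hP, rfl⟩ := ha
      exact ⟨r • P, by simp [MvPolynomial.smul_eq_C_mul, hP], by simp⟩
  · rintro ⟨P, hP, rfl⟩
    obtain ⟨b, hb, hPb⟩ := exists_mem_adjoin_aeval_eq_algebraMap_add x P
    simpa [hPb, hP] using hb

theorem mvPolynomial_aeval_apply_eq_eval {α : Type*} (f : ι → α → R) (P : MvPolynomial ι R)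
    (x : α) :
    MvPolynomial.aeval f P x = MvPolynomial.eval (fun i => f i x) P := by
  rw [← MvPolynomial.coe_aeval_eq_eval]
  exact MvPolynomial.comp_aeval_apply f (Pi.evalAlgHom R (fun _ : α => R) x) P

end Polynomials

section Generators

theorem isFreelyGeneratedBy_adjoin_of_algebraicIndependent {K : Type v} {A : Type u} [Field K]
    [CommRing A] [Algebra K A] {X : Set A} (hX : AlgebraicIndependent K ((↑) : X → A)) :
    IsFreelyGeneratedBy (NonUnitalAlgebra.adjoin K X) X :=
  ⟨rfl, fun P _ hP => algebraicIndependent_iff.1 hX P hP⟩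

theorem IsFreelyGeneratedBy.aeval_mem_and_ne_zero {K : Type v} {A : Type u} [Field K]
    [CommRing A] [Algebra K A] {B : NonUnitalSubalgebra K A} {X : Set A}
    (hX : IsFreelyGeneratedBy B X) {a : A} (ha : a ∈ X) {p : Polynomial K} (hp : p ≠ 0)
    (hp0 : p.eval 0 = 0) : Polynomial.aeval a p ∈ B ∧ Polynomial.aeval a p ≠ 0 := by
  obtain ⟨rfl, hfree⟩ := hX
  let P : MvPolynomial X K := Polynomial.aeval (MvPolynomial.X ⟨a, ha⟩) p
  have hP : P ≠ 0 := fun h =>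
    hp ((transcendental_iff.1 (MvPolynomial.transcendental_X K _)) p h)
  have hP0 : MvPolynomial.constantCoeff P = 0 := by
    rw [Polynomial.map_aeval_eq_aeval_map (φ := RingHom.id K) (by ext; simp), Polynomial.map_id,
      MvPolynomial.constantCoeff_X, Polynomial.coe_aeval_eq_eval, hp0]
  have hPa : MvPolynomial.aeval ((↑) : X → A) P = Polynomial.aeval a p := by
    rw [← Polynomial.aeval_algHom_apply, MvPolynomial.aeval_X]
  refine ⟨?_, fun h => hP (hfree P hP0 (hPa.trans h))⟩
  rw [← Subtype.range_coe (s := X)]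
  exact mem_nonUnitalAdjoin_range_iff.2 ⟨P, hP0, hPa⟩

theorem cardinalMk_nonUnitalAdjoin_le (R : Type u) {A : Type u} [CommSemiring R] [Semiring A]
    [Algebra R A] (X : Set A) : #(NonUnitalAlgebra.adjoin R X) ≤ #R ⊔ #X ⊔ ℵ₀ :=
  (mk_le_mk_of_subset (NonUnitalAlgebra.adjoin_le
    (S := (Algebra.adjoin R X).toNonUnitalSubalgebra) Algebra.subset_adjoin)).trans
    (Algebra.cardinalMk_adjoin_le R X)

theorem isGeneratedByCard_adjoin {K A : Type u} [Field K] [CommRing A] [Algebra K A] {X : Set A}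
    (hX : #K ⊔ ℵ₀ < #X) : IsGeneratedByCard (NonUnitalAlgebra.adjoin K X) #X := by
  refine ⟨⟨X, rfl, rfl⟩, fun Y hY => ?_⟩
  have hXY : #X ≤ #K ⊔ #Y ⊔ ℵ₀ := by
    refine (mk_le_mk_of_subset (NonUnitalAlgebra.subset_adjoin K)).trans ?_
    rw [← hY]
    exact cardinalMk_nonUnitalAdjoin_le K Y
  rw [sup_right_comm] at hXY
  exact (le_sup_iff.1 hXY).resolve_left hX.not_ge

end Generators

section IndependentFamilies

/-- A family of functions `F i : α → β` is independent on a collection `𝒞` of subsets of `α` if any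
finitely many of its members take any prescribed values simultaneously at some point of each set
in `𝒞`. -/
def IsIndependentOn {ι α β : Type*} (𝒞 : Set (Set α)) (F : ι → α → β) : Prop :=
  ∀ C ∈ 𝒞, ∀ (s : Finset ι) (y : ι → β), ∃ x ∈ C, ∀ i ∈ s, F i x = y i

theorem exists_injective_forall_mem {ι : Type u} {α : Type v} (S : ι → Set α)
    (hS : ∀ i, lift.{v} #ι ≤ lift.{u} #(S i)) :
    ∃ x : ι → α, Function.Injective x ∧ ∀ i, x i ∈ S i := by
  obtain ⟨r, hr, hord⟩ := exists_ord_eq ι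
  have exists_fresh : ∀ (i : ι) (g : ∀ j, r j i → α), ∃ a ∈ S i, ∀ j (h : r j i), a ≠ g j h := by
    intro i g
    by_contra! hcovered
    have hsub : S i ⊆ range fun j : {j // r j i} => g j.1 j.2 := fun a ha =>
      let ⟨j, hj, haj⟩ := hcovered a ha
      ⟨⟨j, hj⟩, haj.symm⟩
    have hle : lift.{u} #(S i) ≤ lift.{v} #{j // r j i} :=
      (lift_le.2 (mk_le_mk_of_subset hsub)).trans mk_range_le_lift
    have hlt : #{j // r j i} < #ι := card_typein_lt i hord
    exact ((hS i).trans hle).not_gt (lift_lt.2 hlt)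
  choose c hcS hcne using exists_fresh
  let x : ι → α := hr.wf.fix c
  have hx : ∀ i, x i = c i fun j _ => x j := fun i => hr.wf.fix_eq c i
  have hne : ∀ i j, r j i → x i ≠ x j := fun i j h => by
    rw [hx i]
    exact hcne i (fun j _ => x j) j h
  refine ⟨x, fun i j hij => ?_, fun i => hx i ▸ hcS i _⟩
  rcases trichotomous_of r i j with h | h | h
  · exact absurd hij.symm (hne j i h)
  · exact h
  · exact absurd hij (hne i j h)

theorem exists_forall_image_eq_univ {α β : Type u} [Nonempty β] {𝒞 : Set (Set α)}
    (h𝒞 : ∀ C ∈ 𝒞, #𝒞 * #β ≤ #C) : ∃ φ : α → β, ∀ C ∈ 𝒞, φ '' C = Set.univ := by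
  obtain ⟨x, hx, hxC⟩ := exists_injective_forall_mem (fun j : 𝒞 × β => (j.1 : Set α))
    fun j => by simpa using h𝒞 j.1 j.1.2
  refine ⟨Function.extend x Prod.snd fun _ => Classical.arbitrary β, fun C hC => ?_⟩
  exact eq_univ_of_forall fun b => ⟨x (⟨C, hC⟩, b), hxC (⟨C, hC⟩, b), hx.extend_apply _ _ _⟩

theorem exists_finset_inter_injOn {α : Type*} (V : Finset (Set α)) :
    ∃ F : Finset α, InjOn (fun A : Set α => (F : Set α) ∩ A) V := by
  classical
  have separate : ∀ A B : Set α, ∃ F : Finset α, (F : Set α) ∩ A = ↑F ∩ B → A = B := by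
    intro A B
    by_cases hAB : A = B
    · exact ⟨∅, fun _ => hAB⟩
    · obtain ⟨t, ht⟩ : ∃ t, ¬(t ∈ A ↔ t ∈ B) := by simpa [Set.ext_iff] using hAB
      refine ⟨{t}, fun h => absurd ?_ ht⟩
      simpa using Set.ext_iff.1 h t
  choose G hG using separate
  refine ⟨(V ×ˢ V).biUnion fun p => G p.1 p.2, fun A hA B hB hAB => hG A B ?_⟩
  have hsub : (G A B : Set α) ⊆ ((V ×ˢ V).biUnion fun p => G p.1 p.2 : Finset α) := by
    exact_mod_cast Finset.subset_biUnion_of_mem (fun p : Set α × Set α => G p.1 p.2)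
      (Finset.mk_mem_product hA hB)
  rw [← inter_eq_left.2 hsub, inter_assoc, inter_assoc]
  exact congrArg _ hAB

theorem exists_isIndependentOn_univ {γ β : Type u} [Infinite γ] [Nonempty β] (hβ : #β ≤ #γ) :
    ∃ F : Set γ → γ → β, IsIndependentOn {Set.univ} F := by
  classical
  /- The Fichtenholz–Kantorovich–Hausdorff construction: a point is a finite set `E` together with a
  finitely supported assignment of values to finite sets, and the function with index `A` returns
  the value assigned to the trace of `A` on `E`. On a suitable `E`, finitely many indices have
  pairwise distinct traces. -/
  let _ : Zero β := ⟨Classical.arbitrary β⟩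
  have hcard : #(Finset γ × (Finset γ →₀ β)) ≤ #γ := by
    have hβγ : #γ * #β ≤ #γ := (mul_le_mul' le_rfl hβ).trans (mul_eq_self (aleph0_le_mk γ)).le
    have hfinsupp : #(Finset γ →₀ β) ≤ #γ :=
      (mk_le_of_injective (Finsupp.graph_injective _ _)).trans (by simpa using hβγ)
    simpa using (mul_le_mul' le_rfl hfinsupp).trans (mul_eq_self (aleph0_le_mk γ)).le
  obtain ⟨e⟩ := hcard
  let trace : Set γ → Finset γ → Finset γ := fun A E => E.filter (· ∈ A)
  let G : Set γ → Finset γ × (Finset γ →₀ β) → β := fun A p => p.2 (trace A p.1)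
  refine ⟨fun A => Function.extend e (G A) 0, ?_⟩
  rintro _ rfl V y
  obtain ⟨E, hE⟩ := exists_finset_inter_injOn V
  have htrace : InjOn (fun A => trace A E) V := fun A hA B hB hAB => hE hA hB <| by
    simpa [trace, ← Finset.coe_inj, ← sep_mem_eq] using hAB
  let w : Finset γ → β := Function.extend (fun A : V => trace A E) (fun A => y A) 0
  have hw : ∀ A ∈ V, w (trace A E) = y A := fun A hA =>
    htrace.injective.extend_apply _ _ (⟨A, hA⟩ : V)
  let ψ : Finset γ →₀ β := Finsupp.onFinset (V.image fun A => trace A E) w fun t ht => by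
    by_contra hne
    exact ht (Function.extend_apply' _ _ _ fun ⟨A, hA⟩ => hne (hA ▸ Finset.mem_image_of_mem _ A.2))
  exact ⟨e (E, ψ), mem_univ _, fun A hA => (e.injective.extend_apply _ _ _).trans (hw A hA)⟩

namespace IsIndependentOn

variable {ι α β : Type*} {𝒞 : Set (Set α)}

theorem comp {γ : Type*} {F : ι → γ → β} (hF : IsIndependentOn {Set.univ} F) {φ : α → γ}
    (hφ : ∀ C ∈ 𝒞, φ '' C = Set.univ) : IsIndependentOn 𝒞 fun i => F i ∘ φ := by
  intro C hC s y
  obtain ⟨z, -, hz⟩ := hF Set.univ rfl s y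
  obtain ⟨x, hxC, rfl⟩ : z ∈ φ '' C := hφ C hC ▸ mem_univ z
  exact ⟨x, hxC, hz⟩

theorem injective [Nontrivial β] {F : ι → α → β} (hF : IsIndependentOn 𝒞 F) (h𝒞 : 𝒞.Nonempty) :
    Function.Injective F := by
  classical
  intro i j hij
  by_contra hne
  obtain ⟨C, hC⟩ := h𝒞
  obtain ⟨a, b, hab⟩ := exists_pair_ne β
  obtain ⟨x, -, hx⟩ := hF C hC {i, j} (Function.update (fun _ => b) i a)
  have hi : F i x = a := by simpa using hx i (by simp)
  have hj : F j x = b := by simpa [Ne.symm hne] using hx j (by simp)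
  exact hab (hi.symm.trans ((congrFun hij x).trans hj))

theorem image_aeval_eq_range {R : Type*} [CommSemiring R] {T : Set R} {F : ι → α → T}
    (hF : IsIndependentOn 𝒞 F) {C : Set α} (hC : C ∈ 𝒞) (P : MvPolynomial ι R) :
    MvPolynomial.aeval (fun i x => (F i x : R)) P '' C =
      range fun y : ι → T => MvPolynomial.eval (fun i => (y i : R)) P := by
  refine Subset.antisymm (image_subset_iff.2 fun x _ => ?_) (range_subset_iff.2 fun y => ?_)
  · rw [mem_preimage, mvPolynomial_aeval_apply_eq_eval]
    exact mem_range_self fun i => F i x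
  · obtain ⟨x, hxC, hx⟩ := hF C hC P.vars y
    refine ⟨x, hxC, ?_⟩
    rw [mvPolynomial_aeval_apply_eq_eval]
    exact MvPolynomial.eval₂Hom_congr' rfl (fun i hi _ => congrArg _ (hx i hi)) rfl

theorem algebraicIndependent {R : Type*} [CommRing R] [IsDomain R] {T : Set R} (hT : T.Infinite)
    {F : ι → α → T} (hF : IsIndependentOn 𝒞 F) (h𝒞 : 𝒞.Nonempty) :
    AlgebraicIndependent R fun i x => (F i x : R) := by
  refine algebraicIndependent_iff.2 fun P hP => ?_
  obtain ⟨C, hC⟩ := h𝒞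
  refine MvPolynomial.funext_set (fun _ => T) (fun _ => hT) fun y hy => ?_
  obtain ⟨x, -, hx⟩ :
      MvPolynomial.eval y P ∈ MvPolynomial.aeval (fun i x => (F i x : R)) P '' C :=
    hF.image_aeval_eq_range hC P ▸ ⟨fun i => ⟨y i, hy i trivial⟩, rfl⟩
  rw [← hx, hP, map_zero, Pi.zero_apply]

end IsIndependentOn

end IndependentFamilies

section UncountableCompacts

/-- The collection of uncountable compact subsets of `α`. -/
def uncountableCompacts (α : Type*) [TopologicalSpace α] : Set (Set α) :=
  {C | IsCompact C ∧ ¬C.Countable}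

theorem mk_uncountableCompacts_le (α : Type u) [TopologicalSpace α] [T2Space α]
    [SecondCountableTopology α] : #(uncountableCompacts α) ≤ 𝔠 := by
  borelize α
  refine (mk_le_mk_of_subset ?_).trans <|
    MeasurableSpace.cardinal_measurableSet_le_continuum (s := TopologicalSpace.countableBasis α) <|
      (TopologicalSpace.countable_countableBasis α).le_aleph0.trans aleph0_le_continuum
  rintro C ⟨hC, -⟩
  have := hC.measurableSet
  rwa [BorelSpace.measurable_eq (α := α),
    (TopologicalSpace.isBasis_countableBasis α).borel_eq_generateFrom] at this

theorem continuum_le_mk_of_mem_uncountableCompacts {α : Type u} [TopologicalSpace α]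
    [PolishSpace α] {C : Set α} (hC : C ∈ uncountableCompacts α) : 𝔠 ≤ #C := by
  obtain ⟨f, hfC, -, hf⟩ := hC.1.isClosed.exists_nat_bool_injection_of_not_countable hC.2
  have hinj : Function.Injective fun y => (⟨f y, hfC (mem_range_self y)⟩ : C) :=
    fun y z h => hf (congrArg Subtype.val h)
  simpa using lift_mk_le_lift_mk_of_injective hinj

theorem exists_isIndependentOn_uncountableCompacts {γ α β : Type u} [TopologicalSpace α]
    [PolishSpace α] [Nonempty β] (hγ : #γ = 𝔠) (hβ : #β ≤ 𝔠) :
    ∃ F : Set γ → α → β, IsIndependentOn (uncountableCompacts α) F := by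
  have : Infinite γ := infinite_iff.2 (hγ ▸ aleph0_le_continuum)
  obtain ⟨F, hF⟩ := exists_isIndependentOn_univ (hβ.trans hγ.ge)
  obtain ⟨φ, hφ⟩ : ∃ φ : α → γ, ∀ C ∈ uncountableCompacts α, φ '' C = Set.univ :=
    exists_forall_image_eq_univ fun C hC =>
      calc #(uncountableCompacts α) * #γ ≤ 𝔠 * 𝔠 :=
            mul_le_mul' (mk_uncountableCompacts_le α) hγ.le
        _ = 𝔠 := continuum_mul_self
        _ ≤ #C := continuum_le_mk_of_mem_uncountableCompacts hC
  exact ⟨_, hF.comp hφ⟩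

theorem Icc_mem_uncountableCompacts {a b : ℝ} (hab : a < b) : Icc a b ∈ uncountableCompacts ℝ :=
  ⟨isCompact_Icc, fun h => (mk_Icc_real hab ▸ h.le_aleph0).not_gt aleph0_lt_continuum⟩

theorem nowhereContinuous_of_image_eq {f : ℝ → ℝ} {V : Set ℝ} (hV : V.Nontrivial)
    (hf : ∀ C ∈ uncountableCompacts ℝ, f '' C = V) : NowhereContinuous f := by
  intro x hx
  obtain ⟨v, hv, hvx⟩ := hV.exists_ne (f x)
  obtain ⟨ε, hε, hball⟩ := Metric.nhds_basis_closedBall.mem_iff.1 (hx.eventually_ne hvx.symm)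
  rw [Real.closedBall_eq_Icc] at hball
  rw [← hf _ (Icc_mem_uncountableCompacts (by linarith : x - ε < x + ε))] at hv
  obtain ⟨t, ht, htv⟩ := hv
  exact hball ht htv

theorem isDarboux_of_image_eq {f : ℝ → ℝ} {V : Set ℝ} (hV : IsConnected V)
    (hf : ∀ C ∈ uncountableCompacts ℝ, f '' C = V) : IsDarboux f := by
  intro C hC
  rcases C.subsingleton_or_nontrivial with hsub | hnontrivial
  · exact ⟨hC.nonempty.image f, (hsub.image f).isPreconnected⟩
  · obtain ⟨a, ha, b, hb, hab⟩ := hnontrivial.exists_lt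
    have hVC : V ⊆ f '' C := hf _ (Icc_mem_uncountableCompacts hab) ▸
      image_mono (hC.isPreconnected.Icc_subset ha hb)
    have hCV : f '' C ⊆ V := image_subset_iff.2 fun x _ =>
      hf _ (Icc_mem_uncountableCompacts (lt_add_one x)) ▸
        mem_image_of_mem f (left_mem_Icc.2 (lt_add_one x).le)
    rwa [hCV.antisymm hVC]

theorem IsIndependentOn.nowhereContinuous_of_mem_adjoin {ι : Type*} {T : Set ℝ} (hT : (0 : ℝ) ∈ T)
    {F : ι → ℝ → T} (hF : IsIndependentOn (uncountableCompacts ℝ) F) {g : ℝ → ℝ}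
    (hg : g ∈ NonUnitalAlgebra.adjoin ℝ (range fun i x => (F i x : ℝ))) (hg0 : g ≠ 0) :
    NowhereContinuous g := by
  obtain ⟨P, hP, rfl⟩ := mem_nonUnitalAdjoin_range_iff.1 hg
  refine nowhereContinuous_of_image_eq ?_ fun C hC => hF.image_aeval_eq_range hC P
  obtain ⟨x, hx⟩ := Function.ne_iff.1 hg0
  rw [mvPolynomial_aeval_apply_eq_eval] at hx
  refine ⟨_, mem_range_self fun i => F i x, 0, ⟨fun _ => ⟨0, hT⟩, ?_⟩, hx⟩
  exact (congrArg (fun φ => φ P) MvPolynomial.eval_zero').trans hP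

end UncountableCompacts

section FiniteRange

/-- The subalgebra of functions `α → R` taking only finitely many values. -/
def finiteRangeSubalgebra (α R : Type*) [CommSemiring R] : NonUnitalSubalgebra R (α → R) where
  carrier := {f | (range f).Finite}
  zero_mem' := (finite_singleton 0).subset (range_subset_iff.2 fun _ => rfl)
  add_mem' hf hg := (hf.add hg).subset <| range_subset_iff.2 fun x =>
    add_mem_add (mem_range_self x) (mem_range_self x)
  mul_mem' hf hg := (hf.mul hg).subset <| range_subset_iff.2 fun x =>
    mul_mem_mul (mem_range_self x) (mem_range_self x)
  smul_mem' c _ hf := (hf.image (c • ·)).subset <| range_subset_iff.2 fun x =>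
    mem_image_of_mem _ (mem_range_self x)

theorem compactPreserving_of_finite_range {f : ℝ → ℝ} (hf : (range f).Finite) :
    CompactPreserving f :=
  fun C _ => (hf.subset (image_subset_range f C)).isCompact

end FiniteRange

section ImagesOfCompactSets

variable {X Y : Type*} [TopologicalSpace X] [TopologicalSpace Y] {f : X → Y}

theorem isCompact_insert_image_comp (hf : ∀ C, IsCompact C → IsCompact (f '' C)) {ι : Type*}
    {u : ι → X} {x : X} (hu : Tendsto u cofinite (𝓝 x)) (s : Set ι) :
    IsCompact (insert (f x) ((f ∘ u) '' s)) := by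
  have hus : Tendsto (fun i : s => u i) cofinite (𝓝 x) :=
    hu.comp Subtype.val_injective.tendsto_cofinite
  rw [image_eq_range]
  have hcompact := hf _ hus.isCompact_insert_range_of_cofinite
  rwa [image_insert_eq, ← range_comp] at hcompact

theorem tendsto_cofinite_comp_of_isCompact_image [T2Space Y]
    (hf : ∀ C, IsCompact C → IsCompact (f '' C)) {ι : Type*} {u : ι → X} {x : X}
    (hu : Tendsto u cofinite (𝓝 x)) (hfu : Function.Injective (f ∘ u)) :
    Tendsto (f ∘ u) cofinite (𝓝 (f x)) := by
  rw [tendsto_nhds]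
  intro V hV hxV
  by_contra hinf
  /- Infinitely many values outside `V` accumulate at one of them, say `f (u j)`. Without the index
  `j` they still form, together with `f x`, a compact set, which misses `f (u j)`. -/
  let s : Set ι := (f ∘ u ⁻¹' V)ᶜ
  have hinf_image : ((f ∘ u) '' s).Infinite := Set.Infinite.image hfu.injOn hinf
  obtain ⟨z, hz, hacc⟩ := hinf_image.exists_accPt_of_subset_isCompact
    (isCompact_insert_image_comp hf hu s) (subset_insert _ _)
  have hzV : z ∉ V := hV.isClosed_compl.closure_subset_iff.2
    (image_subset_iff.2 fun _ hi => hi) hacc.clusterPt.mem_closure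
  obtain rfl | ⟨j, -, rfl⟩ := hz
  · exact hzV hxV
  have hsub : (f ∘ u) '' s \ {(f ∘ u) j} ⊆ insert (f x) ((f ∘ u) '' (s \ {j})) := by
    rintro _ ⟨⟨i, hi, rfl⟩, hij⟩
    exact Or.inr ⟨i, ⟨hi, fun h => hij (congrArg (f ∘ u) h)⟩, rfl⟩
  rcases closure_minimal hsub (isCompact_insert_image_comp hf hu _).isClosed
    (accPt_principal_iff_clusterPt.1 hacc).mem_closure with hjx | ⟨i, hi, hij⟩
  · exact hzV (mem_of_eq_of_mem hjx hxV)
  · exact hi.2 (hfu hij)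

theorem exists_finite_image_diff_of_isCompact_image [FirstCountableTopology X] [T2Space Y]
    (hf : ∀ C, IsCompact C → IsCompact (f '' C)) {x : X} {V : Set Y} (hV : V ∈ 𝓝 (f x)) :
    ∃ U ∈ 𝓝 x, (f '' U \ V).Finite := by
  by_contra! hinf
  obtain ⟨b, hb⟩ := (𝓝 x).exists_antitone_basis
  obtain ⟨y, hy, hyb⟩ := exists_injective_forall_mem (fun n : ℕ => f '' b n \ V) fun n => by
    have : Infinite ↥(f '' b n \ V) := (hinf _ (hb.mem n)).to_subtype
    simp
  choose u hub hfu using fun n => (hyb n).1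
  obtain rfl : f ∘ u = y := funext hfu
  have hu : Tendsto u cofinite (𝓝 x) := Nat.cofinite_eq_atTop ▸ hb.tendsto hub
  obtain ⟨n, hn⟩ := ((tendsto_cofinite_comp_of_isCompact_image hf hu hy).eventually hV).exists
  exact (hyb n).2 hn

theorem exists_finite_image_of_not_continuousAt [FirstCountableTopology X] [T3Space Y]
    (hf : ∀ C, IsCompact C → IsCompact (f '' C)) {x : X} (hx : ¬ContinuousAt f x) :
    ∃ y, ∃ U ∈ 𝓝 y, (f '' U).Finite := by
  obtain ⟨V, hV, hxV⟩ : ∃ V ∈ 𝓝 (f x), f ⁻¹' V ∉ 𝓝 x := by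
    simpa only [ContinuousAt, tendsto_def, not_forall, exists_prop] using hx
  obtain ⟨W, hW, hWclosed, hWV⟩ := exists_mem_nhds_isClosed_subset hV
  obtain ⟨U, hU, hUfin⟩ := exists_finite_image_diff_of_isCompact_image hf hW
  obtain ⟨y, hyV, hyU⟩ : ∃ y, f y ∉ V ∧ U ∈ 𝓝 y :=
    ((not_eventually.1 hxV).and_eventually (eventually_mem_nhds_iff.2 hU)).exists
  have hyW : Wᶜ ∈ 𝓝 (f y) := hWclosed.isOpen_compl.mem_nhds fun h => hyV (hWV h)
  obtain ⟨U', hU', hU'fin⟩ := exists_finite_image_diff_of_isCompact_image hf hyW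
  refine ⟨y, U ∩ U', inter_mem hyU hU', (hUfin.union hU'fin).subset ?_⟩
  rintro _ ⟨t, ⟨htU, htU'⟩, rfl⟩
  by_cases htW : f t ∈ W
  · exact Or.inr ⟨mem_image_of_mem f htU', not_not_intro htW⟩
  · exact Or.inl ⟨mem_image_of_mem f htU, htW⟩

theorem exists_polynomial_aeval_eventuallyEq_zero {K : Type*} [CommRing K] [IsDomain K]
    {g : X → K} {y : X} {U : Set X} (hU : U ∈ 𝓝 y) (hfin : (g '' U).Finite) :
    ∃ p : Polynomial K, p ≠ 0 ∧ p.eval 0 = 0 ∧ Polynomial.aeval g p =ᶠ[𝓝 y] 0 := by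
  let q : Polynomial K := ∏ v ∈ hfin.toFinset, (Polynomial.X - Polynomial.C v)
  refine ⟨Polynomial.X * q, ?_, by simp, ?_⟩
  · exact mul_ne_zero Polynomial.X_ne_zero
      (Finset.prod_ne_zero_iff.2 fun v _ => Polynomial.X_sub_C_ne_zero v)
  · filter_upwards [hU] with t ht
    have hq : q.eval (g t) = 0 := by
      rw [Polynomial.eval_prod]
      exact Finset.prod_eq_zero (hfin.mem_toFinset.2 (mem_image_of_mem g ht)) (by simp)
    simp [Polynomial.aeval_fn_apply, hq]

end ImagesOfCompactSets

theorem isStronglyAlgebrable_nowhereContinuous_darboux :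
    IsStronglyAlgebrable ℝ ((2 : Cardinal.{0}) ^ 𝔠)
      {f : ℝ → ℝ | NowhereContinuous f ∧ IsDarboux f ∧ UncountableCompactPreserving f} := by
  obtain ⟨F, hF⟩ := exists_isIndependentOn_uncountableCompacts (α := ℝ) (β := unitInterval)
    mk_real ((mk_subtype_le _).trans mk_real.le)
  let f : Set ℝ → ℝ → ℝ := fun i x => F i x
  have hf : AlgebraicIndependent ℝ f :=
    hF.algebraicIndependent (Icc_infinite one_pos) ⟨_, Icc_mem_uncountableCompacts one_pos⟩
  refine ⟨NonUnitalAlgebra.adjoin ℝ (range f), fun g hg => or_iff_not_imp_right.2 fun hg0 => ?_,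
    range f, by simp [mk_range_eq f hf.injective, mk_real],
    isFreelyGeneratedBy_adjoin_of_algebraicIndependent hf.coe_range⟩
  refine ⟨hF.nowhereContinuous_of_mem_adjoin unitInterval.zero_mem hg hg0, ?_⟩
  obtain ⟨P, -, rfl⟩ := mem_nonUnitalAdjoin_range_iff.1 hg
  have hcont : Continuous fun y : Set ℝ → unitInterval => P.eval fun i => (y i : ℝ) :=
    (MvPolynomial.continuous_eval P).comp (by fun_prop)
  refine ⟨isDarboux_of_image_eq (isConnected_range hcont) fun C hC => hF.image_aeval_eq_range hC P,
    fun C hC hunc => ?_⟩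
  rw [hF.image_aeval_eq_range ⟨hC, hunc⟩ P]
  exact isCompact_range hcont

theorem isAlgebrable_nowhereContinuous_compactPreserving :
    IsAlgebrable ℝ ((2 : Cardinal.{0}) ^ 𝔠)
      {f : ℝ → ℝ | NowhereContinuous f ∧ CompactPreserving f} := by
  let T : Set ℝ := {0, 1}
  have : Nontrivial T := (nontrivial_pair zero_ne_one).coe_sort
  obtain ⟨F, hF⟩ := exists_isIndependentOn_uncountableCompacts (α := ℝ) (β := T) mk_real
    ((mk_subtype_le _).trans mk_real.le)
  let f : Set ℝ → ℝ → ℝ := fun i x => F i x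
  have hf : Function.Injective f := Subtype.val_injective.comp_left.comp
    (hF.injective ⟨_, Icc_mem_uncountableCompacts one_pos⟩)
  have hcard : #(range f) = 2 ^ 𝔠 := by simp [mk_range_eq f hf, mk_real]
  have hrange : NonUnitalAlgebra.adjoin ℝ (range f) ≤ finiteRangeSubalgebra ℝ ℝ := by
    refine NonUnitalAlgebra.adjoin_le ?_
    rintro _ ⟨i, rfl⟩
    exact (toFinite T).subset (range_subset_iff.2 fun x => (F i x).2)
  refine ⟨NonUnitalAlgebra.adjoin ℝ (range f), fun g hg => or_iff_not_imp_right.2 fun hg0 => ?_, ?_⟩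
  · exact ⟨hF.nowhereContinuous_of_mem_adjoin (by simp [T]) hg hg0,
      compactPreserving_of_finite_range (hrange hg)⟩
  · rw [← hcard]
    exact isGeneratedByCard_adjoin (by simpa [hcard, mk_real, aleph0_le_continuum] using cantor 𝔠)

theorem not_isStronglyAlgebrable_nowhereContinuous_compactPreserving {κ : Cardinal.{0}}
    (hκ : κ ≠ 0) :
    ¬IsStronglyAlgebrable ℝ κ {f : ℝ → ℝ | NowhereContinuous f ∧ CompactPreserving f} := by
  rintro ⟨B, hB, X, rfl, hX⟩
  obtain ⟨f, hfX⟩ := nonempty_iff_ne_empty.2 fun h => hκ (mk_set_eq_zero_iff.2 h)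
  have mem_of_ne_zero : ∀ p : Polynomial ℝ, p ≠ 0 → p.eval 0 = 0 →
      NowhereContinuous (Polynomial.aeval f p) ∧ CompactPreserving (Polynomial.aeval f p) :=
    fun p hp hp0 =>
      have ⟨hpB, hpf⟩ := hX.aeval_mem_and_ne_zero hfX hp hp0
      (hB hpB).resolve_right hpf
  obtain ⟨hf, hfcompact⟩ : NowhereContinuous f ∧ CompactPreserving f := by
    simpa using mem_of_ne_zero Polynomial.X Polynomial.X_ne_zero Polynomial.eval_X
  obtain ⟨y, U, hU, hfin⟩ := exists_finite_image_of_not_continuousAt hfcompact (hf 0)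
  obtain ⟨p, hp, hp0, hpy⟩ := exists_polynomial_aeval_eventuallyEq_zero hU hfin
  exact (mem_of_ne_zero p hp hp0).1 y (continuousAt_const.congr hpy.symm)

theorem mainTheorem11 :
    IsStronglyAlgebrable ℝ ((2 : Cardinal.{0}) ^ Cardinal.continuum.{0})
        {f : ℝ → ℝ | NowhereContinuous f ∧ IsDarboux f ∧ UncountableCompactPreserving f} ∧
      IsAlgebrable ℝ ((2 : Cardinal.{0}) ^ Cardinal.continuum.{0})
        {f : ℝ → ℝ | NowhereContinuous f ∧ CompactPreserving f} ∧
      ¬ IsStronglyAlgebrable ℝ 1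
        {f : ℝ → ℝ | NowhereContinuous f ∧ CompactPreserving f} :=
  ⟨isStronglyAlgebrable_nowhereContinuous_darboux, isAlgebrable_nowhereContinuous_compactPreserving,
    not_isStronglyAlgebrable_nowhereContinuous_compactPreserving one_ne_zero⟩
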